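/- Let $L\ge 3$ be odd. For $\theta\in\mathbb R^L$ let $\hat\theta_j=L^{-1/2}\sum_{k=1}^L e^{2\pi i jk/L}\theta_k$ and $\operatorname{supp}(\hat\theta)=\{1\le j\le \lfloor L/2\rfloor:\hat\theta_j\ne 0\}$. In the discrete multi-reference alignment model one observes $n\ge1$ independent copies $Y_1,\dots,Y_n$ of $$Y=G\theta+\sigma\xi ,$$ where $G$ is uniformly distributed on the group $\mathcal C\cong\mathbb Z/L$ of circular shifts of the coordinates of $\mathbb R^L$, and $\xi\sim\mathcal N(0,I_L)$ is independent of $G$. Let $\rho(x,\theta)=\min_{G\in\mathcal C}\|x-G\theta\|$, with $\|\cdot\|$ the Euclidean norm. Given constants $c>1$, $c_0>0$ with $\sqrt2\,c_0\le c$, and an integer $1\le s\le\lfloor L/2\rfloor$, let $\mathcal T_s$ be the set of $\theta\in\mathbb R^L$ such that $c^{-1}\le\|\theta\|\le c$, $|\hat\theta_j|\ge c_0$ for all $j\in\operatorname{supp}(\hat\theta)$, and $\operatorname{supp}(\hat\theta)\subset\{1,\dots,s\}$. Theorem. For any $\sigma\ge\max_{\theta\in\mathcal T_s}\|\theta\|$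 and any $n\ge1$, $$\inf_{T_n}\ \sup_{\theta\in\mathcal T_s}\ \mathbb E_\theta[\rho(T_n,\theta)]\ \ge\ \frac CL\Big(\frac{\sigma^L}{\sqrt n}\wedge 1\Big),$$ where the infimum is over all estimators, i.e. all measurable functions $T_n=T_n(Y_1,\dots,Y_n)$ with values in $\mathbb R^L$, and $C>0$ is a universal constant: it does not depend on $L,s,\sigma,n,c$, and it can be chosen uniformly over all $c_0$ in any bounded range $(0,K]$. -/

import Mathlib

open MeasureTheory ProbabilityTheory
open scoped ENNReal

namespace DiscreteMRA

/-- The space `ℝ^L` with the `ℓ²` norm; the coordinates `1, …, L` are read modulo `L`. -/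
abbrev Signal (L : ℕ) : Type := EuclideanSpace ℝ (ZMod L)

/-- The circular shift by `g`, i.e. the action of `g ∈ ℤ/L` on the coordinates. -/
def shift {L : ℕ} (g : ZMod L) (θ : Signal L) : Signal L :=
  WithLp.toLp 2 fun k => θ (k + g)

/-- The normalized discrete Fourier coefficient `L^{-1/2} ∑_k e^{2π i j k / L} θ_k`. -/
noncomputable def fourierCoeff {L : ℕ} [NeZero L] (θ : Signal L) (j : ℤ) : ℂ :=
  (1 / (Real.sqrt L : ℂ)) *
    ∑ k : ZMod L, Complex.exp (2 * Real.pi * Complex.I * j * (k.val : ℂ) / L) * (θ k : ℂ)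

/-- The positive support of the Fourier transform: the frequencies `1 ≤ j ≤ ⌊L/2⌋` at which the
Fourier coefficient does not vanish. -/
def posSupport {L : ℕ} [NeZero L] (θ : Signal L) : Set ℕ :=
  {j | 1 ≤ j ∧ j ≤ L / 2 ∧ fourierCoeff θ (j : ℤ) ≠ 0}

/-- The class `𝒯_s`: signals with `c⁻¹ ≤ ‖θ‖ ≤ c`, with Fourier coefficients of modulus at least
`c₀` on the positive support, and with positive support contained in `{1, …, s}`. -/
def signalClass (L : ℕ) [NeZero L] (c c₀ : ℝ) (s : ℕ) : Set (Signal L) :=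
  {θ | c⁻¹ ≤ ‖θ‖ ∧ ‖θ‖ ≤ c ∧ (∀ j ∈ posSupport θ, c₀ ≤ ‖fourierCoeff θ (j : ℤ)‖) ∧
    posSupport θ ⊆ Set.Icc 1 s}

/-- The distance between orbits, `ρ(x, θ) = min_{g ∈ ℤ/L} ‖x - g θ‖` (an infimum over a finite
nonempty set). -/
noncomputable def orbitDist {L : ℕ} [NeZero L] (x θ : Signal L) : ℝ :=
  ⨅ g : ZMod L, ‖x - shift g θ‖

/-- The law `P_θ` of one observation `Y = G θ + σ ξ`, where `G` is a uniformly random circular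
shift and `ξ` is a standard Gaussian vector independent of `G`. -/
noncomputable def obsLaw {L : ℕ} [NeZero L] (σ : ℝ) (θ : Signal L) : Measure (Signal L) :=
  ((uniformOn (Set.univ : Set (ZMod L))).prod (stdGaussian (Signal L))).map
    fun p => shift p.1 θ + σ • p.2

/-- The law of `n` independent observations. -/
noncomputable def sampleLaw {L : ℕ} [NeZero L] (n : ℕ) (σ : ℝ) (θ : Signal L) :
    Measure (Fin n → Signal L) :=
  Measure.pi fun _ => obsLaw σ θ

/-- The risk `E_θ[ρ(T(Y₁, …, Yₙ), θ)]`, with values in `[0, ∞]`. -/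
noncomputable def risk {L : ℕ} [NeZero L] (n : ℕ) (σ : ℝ) (T : (Fin n → Signal L) → Signal L)
    (θ : Signal L) : ℝ≥0∞ :=
  ∫⁻ y, ENNReal.ofReal (orbitDist (T y) θ) ∂(sampleLaw n σ θ)

/-- The minimax risk `inf_T sup_{θ ∈ Θ} E_θ[ρ(T, θ)]`, where `T` runs over all estimators, i.e. all
measurable functions of the `n` observations. -/
noncomputable def minimaxRisk {L : ℕ} [NeZero L] (n : ℕ) (σ : ℝ) (Θ : Set (Signal L)) : ℝ≥0∞ :=
  ⨅ T : {T : (Fin n → Signal L) → Signal L // Measurable T}, ⨆ θ ∈ Θ, risk n σ T.1 θ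

end DiscreteMRA

/-! Le Cam's two-point method, with two signals supported on the frequencies ±1, of equal amplitude
`r` and phases `0` and `δ`. A shift multiplies the phase by an `L`-th root of unity, so for `δ ≤
π/L` the orbits stay at distance at least `(2/π) r δ` (`le_orbitDist_wave`). The orbits are
nevertheless hard to tell apart. A moment of order `m` of the shifted phase only sees frequencies
`2k - m` divisible by `L`; for `m < L` this leaves frequency zero, which ignores `δ`
(`orbitMoment_eq_of_lt`). The Gaussian mixtures have correlations that are moment generating
functions at `r²/σ²` (`mixtureCorrelation_wave`), so their squared `L²` distance starts at order
`σ^(-2L)` and is at most a constant times `(δL)² σ^(-2L)` (`orbitMGF_zero_sub_le`). A uniform floor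
for the mixture density (`le_mixtureDensity_wave`) turns this into a chi-square bound. Taking `δL`
proportional to `min (σ^L/√n) 1` keeps the `n`-sample likelihood ratio bounded in `L²`, and the
separation becomes the lower bound. -/

namespace DiscreteMRA

/-! ### Product measures: integrals and densities -/

section Product

variable {ι : Type*} [Fintype ι] {X : ι → Type*} [∀ i, MeasurableSpace (X i)]

theorem lintegral_pi_prod (μ : ∀ i, Measure (X i)) [∀ i, IsProbabilityMeasure (μ i)]
    {f : ∀ i, X i → ℝ≥0∞} (hf : ∀ i, Measurable (f i)) :
    ∫⁻ x, ∏ i, f i (x i) ∂Measure.pi μ = ∏ i, ∫⁻ x, f i x ∂μ i := by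
  have hind : iIndepFun (fun i (x : ∀ i, X i) => f i (x i)) (Measure.pi μ) :=
    iIndepFun_pi (fun i => (hf i).aemeasurable)
  rw [lintegral_prod_eq_prod_lintegral_of_indepFun Finset.univ _ hind
    (fun i => (hf i).comp (measurable_pi_apply i))]
  refine Finset.prod_congr rfl fun i _ => ?_
  have hp : MeasurePreserving (Function.eval i) (Measure.pi μ) (μ i) := measurePreserving_eval μ i
  exact hp.lintegral_comp (hf i)

theorem pi_withDensity (μ : ∀ i, Measure (X i)) [∀ i, IsProbabilityMeasure (μ i)]
    {f : ∀ i, X i → ℝ≥0∞} (hf : ∀ i, Measurable (f i))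
    [∀ i, IsProbabilityMeasure ((μ i).withDensity (f i))] :
    Measure.pi (fun i => (μ i).withDensity (f i)) =
      (Measure.pi μ).withDensity fun x => ∏ i, f i (x i) := by
  apply Measure.pi_eq
  intro s hs
  rw [withDensity_apply _ (MeasurableSet.univ_pi hs), ← lintegral_indicator (.univ_pi hs)]
  have : (Set.univ.pi s).indicator (fun x => ∏ i, f i (x i)) =
      fun x : ∀ i, X i => ∏ i, (s i).indicator (f i) (x i) := by
    ext x
    by_cases hx : x ∈ Set.univ.pi s
    · rw [Set.indicator_of_mem hx]
      exact Finset.prod_congr rfl fun i _ => (Set.indicator_of_mem (hx i trivial) _).symm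
    · rw [Set.indicator_of_notMem hx]
      simp only [Set.mem_pi, Set.mem_univ, true_implies, not_forall] at hx
      obtain ⟨i, hi⟩ := hx
      exact (Finset.prod_eq_zero (Finset.mem_univ i) (Set.indicator_of_notMem hi _)).symm
  rw [this, lintegral_pi_prod μ fun i => (hf i).indicator (hs i)]
  refine Finset.prod_congr rfl fun i _ => ?_
  rw [lintegral_indicator (hs i), withDensity_apply _ (hs i)]

end Product

/-! ### Two-point testing -/

/-- For `a ≥ 1` this is `(a - 2)² ≥ 0`. Integrated against a likelihood ratio with second moment at
most `2`, it gives overlap at least `1 - 2/4`. -/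
theorem le_min_one_add_sq_div_four (a : ℝ≥0∞) : a ≤ min a 1 + a ^ 2 / 4 := by
  induction a with
  | top => simp [ENNReal.top_div]
  | coe a =>
    rcases le_total a 1 with h | h
    · rw [min_eq_left (by exact_mod_cast h)]
      exact le_self_add
    · rw [min_eq_right (by exact_mod_cast h)]
      have : a ≤ 1 + a ^ 2 / 4 := by
        rw [← NNReal.coe_le_coe]
        push_cast
        nlinarith [sq_nonneg ((a : ℝ) - 2)]
      have h4 : ((a ^ 2 / 4 : NNReal) : ℝ≥0∞) = (a : ℝ≥0∞) ^ 2 / 4 := by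
        rw [ENNReal.coe_div (by norm_num)]; push_cast; rfl
      rw [← h4]
      exact_mod_cast this

/-- Le Cam's two-point bound: if the likelihood ratio `f` has second moment at most `2`, two losses
whose sum is at least `D` cannot both have a small mean. -/
theorem le_lintegral_add_lintegral_of_sq_le {X : Type*} [MeasurableSpace X] (ν : Measure X)
    {f : X → ℝ≥0∞} (hf : Measurable f) (hf1 : ∫⁻ x, f x ∂ν = 1) (hf2 : ∫⁻ x, f x ^ 2 ∂ν ≤ 2)
    {a b : X → ℝ≥0∞} (ha : Measurable a) (D : ℝ≥0∞)
    (hab : ∀ x, D ≤ a x + b x) :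
    D / 2 ≤ ∫⁻ x, a x ∂(ν.withDensity f) + ∫⁻ x, b x ∂ν := by
  have hmin : (1 : ℝ≥0∞) / 2 ≤ ∫⁻ x, min (f x) 1 ∂ν := by
    have h : (1 : ℝ≥0∞) ≤ ∫⁻ x, min (f x) 1 ∂ν + 1 / 2 := by
      calc (1 : ℝ≥0∞) = ∫⁻ x, f x ∂ν := hf1.symm
        _ ≤ ∫⁻ x, (min (f x) 1 + f x ^ 2 / 4) ∂ν :=
            lintegral_mono fun x => le_min_one_add_sq_div_four _
        _ = ∫⁻ x, min (f x) 1 ∂ν + (∫⁻ x, f x ^ 2 ∂ν) / 4 := by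
            rw [lintegral_add_left (hf.min measurable_const)]
            simp_rw [div_eq_mul_inv]
            rw [lintegral_mul_const _ (hf.pow_const 2)]
        _ ≤ ∫⁻ x, min (f x) 1 ∂ν + 2 / 4 := by gcongr
        _ = _ := by
            congr 1
            rw [ENNReal.div_eq_div_iff] <;> norm_num
    have h2 : (1 : ℝ≥0∞) - 1 / 2 = 1 / 2 := by
      rw [one_div, ENNReal.one_sub_inv_two]
    rw [← h2]
    exact tsub_le_iff_right.2 h
  calc D / 2 = D * (1 / 2) := by rw [mul_one_div]
    _ ≤ D * ∫⁻ x, min (f x) 1 ∂ν := by gcongr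
    _ = ∫⁻ x, D * min (f x) 1 ∂ν := (lintegral_const_mul _ (hf.min measurable_const)).symm
    _ ≤ ∫⁻ x, (f x * a x + b x) ∂ν := by
        refine lintegral_mono fun x => ?_
        calc D * min (f x) 1 ≤ (a x + b x) * min (f x) 1 := by gcongr; exact hab x
          _ = min (f x) 1 * a x + b x * min (f x) 1 := by ring
          _ ≤ f x * a x + b x * 1 := by
              gcongr
              · exact min_le_left _ _
              · exact min_le_right _ _
          _ = _ := by rw [mul_one]
    _ = _ := by
        rw [lintegral_withDensity_eq_lintegral_mul _ hf ha]
        exact lintegral_add_left (hf.mul ha) _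

/-! ### Translates of the standard Gaussian -/

section Gaussian

theorem gaussianReal_eq_withDensity (h : ℝ) :
    gaussianReal h 1 = (gaussianReal 0 1).withDensity
      fun x => ENNReal.ofReal (Real.exp (h * x - h ^ 2 / 2)) := by
  rw [gaussianReal_of_var_ne_zero _ one_ne_zero, gaussianReal_of_var_ne_zero _ one_ne_zero,
    ← withDensity_mul _ (measurable_gaussianPDF _ _) (by fun_prop)]
  congr 1
  ext x
  rw [Pi.mul_apply, gaussianPDF, gaussianPDF, ← ENNReal.ofReal_mul (gaussianPDFReal_nonneg _ _ _),
    gaussianPDFReal, gaussianPDFReal, mul_assoc (_⁻¹), ← Real.exp_add]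
  congr 3
  simp
  ring

variable {ι : Type*} [Fintype ι]

/-- The density of `N(h, I)` with respect to `N(0, I)`. -/
noncomputable def gaussianTilt (h x : EuclideanSpace ℝ ι) : ℝ :=
  Real.exp (inner ℝ h x - ‖h‖ ^ 2 / 2)

theorem gaussianTilt_pos (h x : EuclideanSpace ℝ ι) : 0 < gaussianTilt h x := Real.exp_pos _

@[fun_prop]
theorem measurable_gaussianTilt (h : EuclideanSpace ℝ ι) : Measurable (gaussianTilt h) := by
  unfold gaussianTilt
  fun_prop

/-- Finite-dimensional Cameron–Martin, reduced to one coordinate at a time by the product structure.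
-/
theorem stdGaussian_map_const_add (h : EuclideanSpace ℝ ι) :
    (stdGaussian (EuclideanSpace ℝ ι)).map (h + ·) =
      (stdGaussian (EuclideanSpace ℝ ι)).withDensity
        fun x => ENNReal.ofReal (gaussianTilt h x) := by
  have hpi : (Measure.pi fun _ : ι => gaussianReal 0 1).map (fun x i => h i + x i) =
      (Measure.pi fun _ : ι => gaussianReal 0 1).withDensity
        fun x => ∏ i, ENNReal.ofReal (Real.exp (h i * x i - h i ^ 2 / 2)) := by
    have hshift : ∀ i, (gaussianReal 0 1).map (fun x => h i + x) = gaussianReal (h i) 1 := fun i => by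
      rw [gaussianReal_map_const_add, zero_add]
    have : ∀ i, IsProbabilityMeasure ((gaussianReal 0 1).withDensity
        fun x => ENNReal.ofReal (Real.exp (h i * x - h i ^ 2 / 2))) := fun i => by
      rw [← gaussianReal_eq_withDensity]; infer_instance
    have : ∀ i, SigmaFinite ((gaussianReal 0 1).map (fun x => h i + x)) := fun i => by
      rw [hshift]; infer_instance
    rw [← pi_withDensity (X := fun _ => ℝ) (fun _ : ι => gaussianReal 0 1)
        (f := fun i x => ENNReal.ofReal (Real.exp (h i * x - h i ^ 2 / 2))) (by fun_prop),
      Measure.pi_map_pi (f := fun i x => h i + x) (by fun_prop)]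
    simp_rw [hshift, ← gaussianReal_eq_withDensity]
  rw [← map_pi_eq_stdGaussian, Measure.map_map (by fun_prop) (by fun_prop)]
  have hcomp : (fun x => h + x) ∘ (WithLp.toLp 2 : (ι → ℝ) → EuclideanSpace ℝ ι) =
      WithLp.toLp 2 ∘ fun x i => h i + x i := by
    ext x i; simp
  rw [hcomp, ← Measure.map_map (by fun_prop) (by fun_prop), hpi]
  have hmeas : Measurable (WithLp.toLp 2 : (ι → ℝ) → EuclideanSpace ℝ ι) := by fun_prop
  refine Measure.ext fun s hs => ?_
  rw [Measure.map_apply hmeas hs, withDensity_apply _ (hmeas hs), withDensity_apply _ hs,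
    setLIntegral_map hs (by fun_prop) hmeas]
  refine lintegral_congr fun x => ?_
  rw [← ENNReal.ofReal_prod_of_nonneg fun i _ => (Real.exp_pos _).le, ← Real.exp_sum, gaussianTilt]
  congr 2
  rw [EuclideanSpace.real_norm_sq_eq, Finset.sum_sub_distrib, Finset.sum_div, PiLp.inner_apply]
  simp [mul_comm]

theorem lintegral_gaussianTilt (h : EuclideanSpace ℝ ι) :
    ∫⁻ x, ENNReal.ofReal (gaussianTilt h x) ∂stdGaussian (EuclideanSpace ℝ ι) = 1 := by
  rw [← setLIntegral_univ, ← withDensity_apply _ MeasurableSet.univ, ← stdGaussian_map_const_add,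
    Measure.map_apply (by fun_prop) MeasurableSet.univ]
  simp

theorem integrable_gaussianTilt (h : EuclideanSpace ℝ ι) :
    Integrable (gaussianTilt h) (stdGaussian (EuclideanSpace ℝ ι)) := by
  rw [← lintegral_ofReal_ne_top_iff_integrable (by fun_prop)
    (.of_forall fun x => (gaussianTilt_pos h x).le), lintegral_gaussianTilt]
  simp

theorem integral_gaussianTilt (h : EuclideanSpace ℝ ι) :
    ∫ x, gaussianTilt h x ∂stdGaussian (EuclideanSpace ℝ ι) = 1 := by
  rw [integral_eq_lintegral_of_nonneg_ae (.of_forall fun x => (gaussianTilt_pos h x).le)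
    (by fun_prop), lintegral_gaussianTilt, ENNReal.toReal_one]

/-- Completing the square. As every tilt has integral one, two tilts have correlation `exp ⟨h, k⟩`.
-/
theorem gaussianTilt_mul (h k x : EuclideanSpace ℝ ι) :
    gaussianTilt h x * gaussianTilt k x = Real.exp (inner ℝ h k) * gaussianTilt (h + k) x := by
  simp only [gaussianTilt, ← Real.exp_add, inner_add_left, norm_add_sq_real]
  ring_nf

end Gaussian

theorem natCast_ne_zero_of_lt {L a : ℕ} (h0 : 0 < a) (ha : a < L) : (a : ZMod L) ≠ 0 := by
  rw [Ne, ZMod.natCast_eq_zero_iff]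
  exact Nat.not_dvd_of_pos_of_lt h0 ha

/-! ### Shift mixtures and their likelihood ratios -/

variable {L : ℕ} [NeZero L]

theorem norm_shift (g : ZMod L) (θ : Signal L) : ‖shift g θ‖ = ‖θ‖ := by
  rw [EuclideanSpace.norm_eq, EuclideanSpace.norm_eq]
  congr 1
  exact Equiv.sum_comp (Equiv.addRight g) fun k => ‖θ k‖ ^ 2

/-- The density of the law of `Y / σ` with respect to the standard Gaussian measure. -/
noncomputable def mixtureDensity (σ : ℝ) (θ x : Signal L) : ℝ :=
  (L : ℝ)⁻¹ * ∑ g : ZMod L, gaussianTilt (σ⁻¹ • shift g θ) x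

theorem mixtureDensity_pos (σ : ℝ) (θ x : Signal L) : 0 < mixtureDensity σ θ x :=
  mul_pos (inv_pos.2 (Nat.cast_pos.2 (NeZero.pos L)))
    (Finset.sum_pos (fun _ _ => gaussianTilt_pos _ _) Finset.univ_nonempty)

@[fun_prop]
theorem measurable_mixtureDensity (σ : ℝ) (θ : Signal L) : Measurable (mixtureDensity σ θ) := by
  unfold mixtureDensity
  fun_prop

theorem lintegral_uniformOn_univ (f : ZMod L → ℝ≥0∞) :
    ∫⁻ g, f g ∂uniformOn (Set.univ : Set (ZMod L)) = (L : ℝ≥0∞)⁻¹ * ∑ g, f g := by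
  rw [lintegral_fintype, Finset.mul_sum]
  refine Finset.sum_congr rfl fun g _ => ?_
  rw [uniformOn_univ, Measure.count_singleton, ZMod.card, mul_comm, one_div]

instance isProbabilityMeasure_uniformOn_univ :
    IsProbabilityMeasure (uniformOn (Set.univ : Set (ZMod L))) :=
  isProbabilityMeasure_uniformOn Set.finite_univ Set.univ_nonempty

theorem measurable_observation (σ : ℝ) (θ : Signal L) :
    Measurable fun p : ZMod L × Signal L => shift p.1 θ + σ • p.2 := by
  have : Measurable fun g : ZMod L => shift g θ := measurable_of_finite _
  fun_prop

instance isProbabilityMeasure_obsLaw (σ : ℝ) (θ : Signal L) :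
    IsProbabilityMeasure (obsLaw σ θ) :=
  Measure.isProbabilityMeasure_map (measurable_observation σ θ).aemeasurable

/-- Rescaling by `σ` gives all observation laws one common reference measure, the standard Gaussian.
-/
theorem lintegral_obsLaw {σ : ℝ} (hσ : σ ≠ 0) (θ : Signal L) {F : Signal L → ℝ≥0∞}
    (hF : Measurable F) :
    ∫⁻ y, F y ∂obsLaw σ θ =
      ∫⁻ x, ENNReal.ofReal (mixtureDensity σ θ x) * F (σ • x) ∂stdGaussian (Signal L) := by
  have hsm := measurable_observation σ θ
  rw [obsLaw, lintegral_map hF hsm,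
    lintegral_prod (fun p : ZMod L × Signal L => F (shift p.1 θ + σ • p.2))
      (hF.comp hsm).aemeasurable,
    lintegral_uniformOn_univ]
  have key : ∀ g : ZMod L, ∫⁻ x, F (shift g θ + σ • x) ∂stdGaussian (Signal L) =
      ∫⁻ x, ENNReal.ofReal (gaussianTilt (σ⁻¹ • shift g θ) x) * F (σ • x)
        ∂stdGaussian (Signal L) := fun g => by
    have hFs : Measurable fun x : Signal L => F (σ • x) := by fun_prop
    rw [← Pi.mul_def, ← lintegral_withDensity_eq_lintegral_mul _ (by fun_prop) hFs,
      ← stdGaussian_map_const_add, lintegral_map hFs (by fun_prop)]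
    refine lintegral_congr fun x => ?_
    rw [smul_add, smul_inv_smul₀ hσ]
  simp_rw [key]
  rw [← lintegral_finsetSum _ (by fun_prop), ← lintegral_const_mul _ (by fun_prop)]
  refine lintegral_congr fun x => ?_
  rw [mixtureDensity, ENNReal.ofReal_mul (by positivity),
    ENNReal.ofReal_sum_of_nonneg fun _ _ => (gaussianTilt_pos _ _).le, ← Finset.sum_mul, mul_assoc,
    ENNReal.ofReal_inv_of_pos (Nat.cast_pos.2 (NeZero.pos L)), ENNReal.ofReal_natCast]

/-- The likelihood ratio of one observation under `θ` and under `θ'`. -/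
noncomputable def likelihoodRatio (σ : ℝ) (θ θ' y : Signal L) : ℝ≥0∞ :=
  ENNReal.ofReal (mixtureDensity σ θ (σ⁻¹ • y) / mixtureDensity σ θ' (σ⁻¹ • y))

@[fun_prop]
theorem measurable_likelihoodRatio (σ : ℝ) (θ θ' : Signal L) :
    Measurable (likelihoodRatio σ θ θ') := by
  unfold likelihoodRatio
  fun_prop

theorem obsLaw_eq_withDensity {σ : ℝ} (hσ : σ ≠ 0) (θ θ' : Signal L) :
    obsLaw σ θ = (obsLaw σ θ').withDensity (likelihoodRatio σ θ θ') := by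
  refine Measure.ext_of_lintegral _ fun F hF => ?_
  rw [lintegral_withDensity_eq_lintegral_mul _ (by fun_prop) hF, lintegral_obsLaw hσ θ hF,
    lintegral_obsLaw hσ θ' (by fun_prop)]
  refine lintegral_congr fun x => ?_
  rw [Pi.mul_apply, ← mul_assoc, likelihoodRatio, ← ENNReal.ofReal_mul (mixtureDensity_pos _ _ _).le,
    inv_smul_smul₀ hσ, mul_div_cancel₀ _ (mixtureDensity_pos _ _ _).ne']

theorem sampleLaw_eq_withDensity {σ : ℝ} (hσ : σ ≠ 0) (n : ℕ) (θ θ' : Signal L) :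
    sampleLaw n σ θ = (sampleLaw n σ θ').withDensity
      fun y => ∏ i, likelihoodRatio σ θ θ' (y i) := by
  have : IsProbabilityMeasure ((obsLaw σ θ').withDensity (likelihoodRatio σ θ θ')) := by
    rw [← obsLaw_eq_withDensity hσ]; infer_instance
  unfold sampleLaw
  rw [← pi_withDensity (X := fun _ : Fin n => Signal L) (fun _ => obsLaw σ θ')
    (f := fun _ => likelihoodRatio σ θ θ') (by fun_prop), ← obsLaw_eq_withDensity hσ]

/-- The correlation of two mixture densities. -/
noncomputable def mixtureCorrelation (σ : ℝ) (θ θ' : Signal L) : ℝ :=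
  (L : ℝ)⁻¹ * ∑ g : ZMod L, Real.exp (inner ℝ θ (shift g θ') / σ ^ 2)

theorem inner_shift_shift (g h : ZMod L) (θ θ' : Signal L) :
    inner ℝ (shift g θ) (shift h θ') = inner ℝ θ (shift (h - g) θ') := by
  rw [PiLp.inner_apply, PiLp.inner_apply,
    ← Equiv.sum_comp (Equiv.addRight g) fun k => inner ℝ (θ k) (shift (h - g) θ' k)]
  exact Finset.sum_congr rfl fun k _ => by simp [shift]

theorem mixtureDensity_mul (σ : ℝ) (θ θ' x : Signal L) :
    mixtureDensity σ θ x * mixtureDensity σ θ' x =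
      (L : ℝ)⁻¹ * ((L : ℝ)⁻¹ * ∑ g : ZMod L, ∑ h : ZMod L,
        Real.exp (inner ℝ θ (shift (h - g) θ') / σ ^ 2) *
          gaussianTilt (σ⁻¹ • shift g θ + σ⁻¹ • shift h θ') x) := by
  rw [mixtureDensity, mixtureDensity, mul_mul_mul_comm, mul_assoc, Finset.sum_mul_sum]
  congr 2
  refine Finset.sum_congr rfl fun g _ => Finset.sum_congr rfl fun h _ => ?_
  rw [gaussianTilt_mul, real_inner_smul_left, real_inner_smul_right, inner_shift_shift]
  congr 2
  field_simp

theorem integrable_mixtureDensity (σ : ℝ) (θ : Signal L) :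
    Integrable (mixtureDensity σ θ) (stdGaussian (Signal L)) :=
  (integrable_finsetSum _ fun _ _ => integrable_gaussianTilt _).const_mul _

theorem integral_mixtureDensity (σ : ℝ) (θ : Signal L) :
    ∫ x, mixtureDensity σ θ x ∂stdGaussian (Signal L) = 1 := by
  simp_rw [mixtureDensity]
  rw [integral_const_mul, integral_finsetSum _ fun _ _ => integrable_gaussianTilt _]
  simp [integral_gaussianTilt, NeZero.ne]

theorem integrable_mixtureDensity_mul (σ : ℝ) (θ θ' : Signal L) :
    Integrable (fun x => mixtureDensity σ θ x * mixtureDensity σ θ' x)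
      (stdGaussian (Signal L)) := by
  simp_rw [mixtureDensity_mul]
  exact ((integrable_finsetSum _ fun _ _ => integrable_finsetSum _ fun _ _ =>
    (integrable_gaussianTilt _).const_mul _).const_mul _).const_mul _

theorem integral_mixtureDensity_mul (σ : ℝ) (θ θ' : Signal L) :
    ∫ x, mixtureDensity σ θ x * mixtureDensity σ θ' x ∂stdGaussian (Signal L) =
      mixtureCorrelation σ θ θ' := by
  simp_rw [mixtureDensity_mul]
  rw [integral_const_mul, integral_const_mul, integral_finsetSum _ fun _ _ =>
    integrable_finsetSum _ fun _ _ => (integrable_gaussianTilt _).const_mul _]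
  have : ∀ g : ZMod L, ∫ x, ∑ h : ZMod L, Real.exp (inner ℝ θ (shift (h - g) θ') / σ ^ 2) *
      gaussianTilt (σ⁻¹ • shift g θ + σ⁻¹ • shift h θ') x ∂stdGaussian (Signal L) =
      ∑ h : ZMod L, Real.exp (inner ℝ θ (shift h θ') / σ ^ 2) := fun g => by
    rw [integral_finsetSum _ fun _ _ => (integrable_gaussianTilt _).const_mul _]
    simp_rw [integral_const_mul, integral_gaussianTilt, mul_one]
    exact Equiv.sum_comp (Equiv.subRight g) fun h => Real.exp (inner ℝ θ (shift h θ') / σ ^ 2)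
  simp_rw [this, mixtureCorrelation]
  simp [NeZero.ne]

/-- The second moment is one plus the chi-square divergence. Replacing the denominator by its floor
`κ` leaves the squared `L²` distance, which expands into correlations. -/
theorem lintegral_likelihoodRatio_sq_le {σ κ : ℝ} (hσ : σ ≠ 0) (hκ : 0 < κ) (θ θ' : Signal L)
    (hlow : ∀ x, κ ≤ mixtureDensity σ θ' x) :
    ∫⁻ y, likelihoodRatio σ θ θ' y ^ 2 ∂obsLaw σ θ' ≤
      ENNReal.ofReal (1 + κ⁻¹ * (mixtureCorrelation σ θ θ - 2 * mixtureCorrelation σ θ θ'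
        + mixtureCorrelation σ θ' θ')) := by
  set w := mixtureDensity σ θ with hw
  set w' := mixtureDensity σ θ' with hw'
  have hwi := integrable_mixtureDensity σ θ
  have hwi' := integrable_mixtureDensity σ θ'
  have h11 := integrable_mixtureDensity_mul σ θ θ
  have h12 := integrable_mixtureDensity_mul σ θ θ'
  have h22 := integrable_mixtureDensity_mul σ θ' θ'
  have hpt : ∀ x, w' x * (w x / w' x) ^ 2 ≤
      2 * w x - w' x + κ⁻¹ * (w x * w x - 2 * (w x * w' x) + w' x * w' x) := fun x => by
    have hpos : 0 < w' x := mixtureDensity_pos _ _ _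
    -- The part `2w - w'` integrates to one; only the square is left to estimate.
    have h1 : w' x * (w x / w' x) ^ 2 = 2 * w x - w' x + (w' x)⁻¹ * (w x - w' x) ^ 2 := by
      field_simp; ring
    have h2 : (w' x)⁻¹ * (w x - w' x) ^ 2 ≤ κ⁻¹ * (w x - w' x) ^ 2 := by
      gcongr; exact hlow x
    rw [h1]
    linarith
  have hnn : ∀ x, 0 ≤ 2 * w x - w' x + κ⁻¹ * (w x * w x - 2 * (w x * w' x) + w' x * w' x) :=
    fun x => le_trans (mul_nonneg (mixtureDensity_pos _ _ _).le (sq_nonneg _)) (hpt x)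
  have i1 : Integrable (fun x => 2 * w x - w' x) (stdGaussian (Signal L)) :=
    (hwi.const_mul 2).sub hwi'
  have i2 : Integrable (fun x => w x * w x - 2 * (w x * w' x)) (stdGaussian (Signal L)) :=
    h11.sub (h12.const_mul 2)
  have i3 : Integrable (fun x => κ⁻¹ * (w x * w x - 2 * (w x * w' x) + w' x * w' x))
      (stdGaussian (Signal L)) := (i2.add h22).const_mul _
  rw [lintegral_obsLaw hσ θ' (by fun_prop)]
  calc ∫⁻ x, ENNReal.ofReal (w' x) * likelihoodRatio σ θ θ' (σ • x) ^ 2 ∂stdGaussian (Signal L)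
      ≤ ∫⁻ x, ENNReal.ofReal (2 * w x - w' x +
          κ⁻¹ * (w x * w x - 2 * (w x * w' x) + w' x * w' x)) ∂stdGaussian (Signal L) := by
        refine lintegral_mono fun x => ?_
        rw [likelihoodRatio, inv_smul_smul₀ hσ, ← ENNReal.ofReal_pow (div_nonneg
          (mixtureDensity_pos _ _ _).le (mixtureDensity_pos _ _ _).le),
          ← ENNReal.ofReal_mul (mixtureDensity_pos _ _ _).le]
        exact ENNReal.ofReal_le_ofReal (hpt x)
    _ = _ := by
        rw [← ofReal_integral_eq_lintegral_ofReal
          (f := fun x => 2 * w x - w' x + κ⁻¹ * (w x * w x - 2 * (w x * w' x) + w' x * w' x))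
          (i1.add i3) (.of_forall hnn)]
        congr 1
        rw [integral_add i1 i3, integral_sub (hwi.const_mul 2) hwi', integral_const_mul,
          integral_const_mul, integral_add i2 h22, integral_sub h11 (h12.const_mul 2),
          integral_const_mul, integral_mixtureDensity, integral_mixtureDensity,
          integral_mixtureDensity_mul, integral_mixtureDensity_mul, integral_mixtureDensity_mul]
        ring

/-! ### Signals of a single frequency -/

open ZMod ComplexConjugate


theorem norm_stdAddChar (g : ZMod L) : ‖stdAddChar g‖ = 1 := by
  rw [stdAddChar_apply, Circle.norm_coe]

theorem conj_stdAddChar (g : ZMod L) : conj (stdAddChar g) = stdAddChar (-g) := by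
  rw [AddChar.map_neg_eq_inv, Complex.inv_def, Complex.normSq_eq_norm_sq, norm_stdAddChar]
  simp

theorem sum_stdAddChar_mul (a : ZMod L) :
    ∑ k : ZMod L, stdAddChar (k * a) = if a = 0 then (L : ℂ) else 0 := by
  rw [AddChar.sum_mulShift a (isPrimitive_stdAddChar L), ZMod.card]
  split_ifs <;> simp

theorem sum_stdAddChar (hL : 1 < L) : ∑ k : ZMod L, stdAddChar k = (0 : ℂ) := by
  have h1 : (1 : ZMod L) ≠ 0 := by exact_mod_cast natCast_ne_zero_of_lt one_pos hL
  simpa [h1] using sum_stdAddChar_mul (L := L) 1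

/-- The signal with Fourier support `{±1}`, amplitude `‖z‖` and phase `arg z`. -/
noncomputable def wave (z : ℂ) : Signal L :=
  WithLp.toLp 2 fun k => √(2 / L) * (stdAddChar k * z).re

theorem wave_apply (z : ℂ) (k : ZMod L) :
    wave z k = √(2 / L) * (stdAddChar k * z).re := rfl

theorem shift_wave (g : ZMod L) (z : ℂ) : shift g (wave z) = wave (stdAddChar g * z) := by
  ext k
  simp only [shift, wave_apply, AddChar.map_add_eq_mul, mul_assoc]

theorem wave_sub (z w : ℂ) : (wave z - wave w : Signal L) = wave (z - w) := by
  ext k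
  simp only [PiLp.sub_apply, wave_apply, mul_sub, Complex.sub_re]

theorem sum_shift_wave (hL : 1 < L) (z : ℂ) : ∑ g : ZMod L, shift g (wave z) = 0 := by
  ext k
  simp only [WithLp.ofLp_sum, Finset.sum_apply, shift_wave, wave_apply, PiLp.zero_apply]
  rw [← Finset.mul_sum, ← Complex.re_sum, ← Finset.mul_sum, ← Finset.sum_mul, sum_stdAddChar hL]
  simp

/-- A product of two cosines has a constant part and a part of frequency `2`; the latter sums to
zero because `2 ≠ 0` modulo `L`. -/
theorem inner_wave (hL : 2 < L) (z w : ℂ) :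
    inner ℝ (wave z : Signal L) (wave w) = (z * conj w).re := by
  have hpt : ∀ k : ZMod L, inner ℝ (wave z k) (wave w k) =
      (L : ℝ)⁻¹ * ((stdAddChar (k * 2) * (z * w)).re + (z * conj w).re) := fun k => by
    have h1 : (stdAddChar k).re ^ 2 + (stdAddChar k).im ^ 2 = 1 := by
      rw [← one_pow 2, ← norm_stdAddChar k, Complex.sq_norm, Complex.normSq_apply]
      ring
    have h2 : √(2 / L : ℝ) * √(2 / L) = 2 / L := Real.mul_self_sqrt (by positivity)
    have h3 : (stdAddChar k * z).re * (stdAddChar k * w).re =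
        ((stdAddChar k * stdAddChar k * (z * w)).re + (z * conj w).re) / 2 := by
      simp only [Complex.mul_re, Complex.mul_im, Complex.conj_re, Complex.conj_im]
      linear_combination (z.re * w.re + z.im * w.im) / 2 * h1
    rw [mul_two, AddChar.map_add_eq_mul, wave_apply, wave_apply, real_inner_eq_re_inner,
      RCLike.inner_apply, conj_trivial, RCLike.re_to_real]
    linear_combination (stdAddChar k * z).re * (stdAddChar k * w).re * h2 + 2 / L * h3
  have h2 : (2 : ZMod L) ≠ 0 := by exact_mod_cast natCast_ne_zero_of_lt two_pos hL
  rw [PiLp.inner_apply, Finset.sum_congr rfl fun k _ => hpt k, ← Finset.mul_sum,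
    Finset.sum_add_distrib, ← Complex.re_sum, ← Finset.sum_mul, sum_stdAddChar_mul, if_neg h2]
  have hL0 : (L : ℝ) ≠ 0 := Nat.cast_ne_zero.2 (NeZero.ne L)
  simp
  field_simp

theorem norm_wave (hL : 2 < L) (z : ℂ) : ‖(wave z : Signal L)‖ = ‖z‖ := by
  rw [← sq_eq_sq₀ (norm_nonneg _) (norm_nonneg _), ← real_inner_self_eq_norm_sq, inner_wave hL,
    Complex.mul_conj, Complex.ofReal_re, Complex.normSq_eq_norm_sq]

theorem exp_eq_stdAddChar (j : ℤ) (k : ZMod L) :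
    Complex.exp (2 * Real.pi * Complex.I * j * (k.val : ℂ) / L) = stdAddChar (k * (j : ZMod L)) := by
  have : (k * (j : ZMod L)) = ((j * k.val : ℤ) : ZMod L) := by
    push_cast
    rw [ZMod.natCast_zmod_val, mul_comm]
  rw [this, stdAddChar_coe]
  push_cast
  ring_nf

theorem fourierCoeff_wave (z : ℂ) (j : ℤ) :
    fourierCoeff (wave z : Signal L) j =
      (√(2 / L) / (2 * √L) : ℝ) * ((if (j : ZMod L) + 1 = 0 then (L : ℂ) else 0) * z +
        (if (j : ZMod L) - 1 = 0 then (L : ℂ) else 0) * conj z) := by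
  have hpt : ∀ k : ZMod L, stdAddChar (k * (j : ZMod L)) * ((wave z : Signal L) k : ℂ) =
      (√(2 / L) / 2 : ℝ) * (stdAddChar (k * ((j : ZMod L) + 1)) * z +
        stdAddChar (k * ((j : ZMod L) - 1)) * conj z) := fun k => by
    rw [wave_apply, Complex.ofReal_mul, Complex.re_eq_add_conj, map_mul (starRingEnd ℂ), conj_stdAddChar,
      mul_add k, mul_sub k, mul_one, AddChar.map_add_eq_mul, sub_eq_add_neg (k * _),
      AddChar.map_add_eq_mul]
    push_cast
    ring
  simp_rw [fourierCoeff, exp_eq_stdAddChar, hpt]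
  rw [← Finset.mul_sum, Finset.sum_add_distrib, ← Finset.sum_mul, ← Finset.sum_mul,
    sum_stdAddChar_mul, sum_stdAddChar_mul]
  push_cast
  ring

/-- The energy splits evenly between the frequencies `1` and `-1`, distinct for `L > 2`. This is the
source of the `√2` in the condition on `c₀`. -/
theorem norm_fourierCoeff_wave_one (hL : 2 < L) (z : ℂ) :
    ‖fourierCoeff (wave z : Signal L) 1‖ = ‖z‖ / √2 := by
  have h2 : (1 : ZMod L) + 1 ≠ 0 := by
    rw [one_add_one_eq_two]
    exact_mod_cast natCast_ne_zero_of_lt two_pos hL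
  have hL0 : (0 : ℝ) < L := Nat.cast_pos.2 (NeZero.pos L)
  rw [fourierCoeff_wave, Int.cast_one, if_neg h2, if_pos (sub_self _), zero_mul, zero_add, norm_mul,
    norm_mul, RCLike.norm_conj, Complex.norm_real, Complex.norm_natCast, Real.norm_of_nonneg
    (by positivity), Real.sqrt_div (by norm_num)]
  have hs : √(L : ℝ) * √L = L := Real.mul_self_sqrt hL0.le
  have hs2 : √2 * √2 = (2 : ℝ) := Real.mul_self_sqrt (by norm_num)
  have : √(L : ℝ) ≠ 0 := (Real.sqrt_pos.2 hL0).ne'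
  field_simp
  rw [pow_two, pow_two, hs2, hs]
  ring

theorem fourierCoeff_wave_eq_zero {z : ℂ} {j : ℕ} (h1 : 1 < j) (hj : j + 1 < L) :
    fourierCoeff (wave z : Signal L) j = 0 := by
  have hp : ((j : ℤ) : ZMod L) + 1 ≠ 0 := by
    exact_mod_cast natCast_ne_zero_of_lt (a := j + 1) (by omega) hj
  have hm : ((j : ℤ) : ZMod L) - 1 ≠ 0 := by
    have := natCast_ne_zero_of_lt (L := L) (a := j - 1) (by omega) (by omega)
    rw [Nat.cast_sub h1.le] at this
    exact_mod_cast this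
  rw [fourierCoeff_wave, if_neg hp, if_neg hm]
  simp

theorem wave_mem_signalClass (hL : 2 < L) {c c₀ : ℝ} {s : ℕ} (hs : 1 ≤ s) {z : ℂ}
    (h1 : c⁻¹ ≤ ‖z‖) (h2 : ‖z‖ ≤ c) (h3 : √2 * c₀ ≤ ‖z‖) :
    (wave z : Signal L) ∈ signalClass L c c₀ s := by
  have hsupp : ∀ j ∈ posSupport (wave z : Signal L), j = 1 := fun j hj => by
    by_contra hne
    obtain ⟨hj1, hj2, hj3⟩ := hj
    exact hj3 (fourierCoeff_wave_eq_zero (by omega) (by omega))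
  refine ⟨by rwa [norm_wave hL], by rwa [norm_wave hL], fun j hj => ?_, fun j hj => ?_⟩
  · rw [hsupp j hj, Nat.cast_one, norm_fourierCoeff_wave_one hL, le_div_iff₀ (by positivity)]
    linarith
  · rw [hsupp j hj]
    exact ⟨le_rfl, hs⟩

/-! ### Separation of orbits and the density floor -/

theorem orbitDist_triangle (x θ θ' : Signal L) :
    orbitDist θ θ' ≤ orbitDist x θ + orbitDist x θ' := by
  obtain ⟨g, hg⟩ := exists_eq_ciInf_of_finite (f := fun g : ZMod L => ‖x - shift g θ‖)
  obtain ⟨h, hh⟩ := exists_eq_ciInf_of_finite (f := fun g : ZMod L => ‖x - shift g θ'‖)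
  rw [orbitDist, orbitDist, orbitDist, ← hg, ← hh]
  refine (ciInf_le (Set.finite_range _).bddBelow (h - g)).trans ?_
  have : ‖θ - shift (h - g) θ'‖ = ‖shift g θ - shift h θ'‖ := by
    rw [← norm_shift g]
    congr 1
    ext k
    simp [shift, add_assoc]
  rw [this, norm_sub_rev x (shift g θ)]
  exact norm_sub_le_norm_sub_add_norm_sub _ _ _

theorem orbitDist_nonneg (x θ : Signal L) : 0 ≤ orbitDist x θ :=
  Real.iInf_nonneg fun _ => norm_nonneg _

@[fun_prop]
theorem measurable_orbitDist (θ : Signal L) : Measurable fun x => orbitDist x θ := by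
  unfold orbitDist
  exact Measurable.iInf fun g => by fun_prop

/-- After a shift the phases differ by `2x` with `x = πg/L + δ/2`, so the distance is the chord `2r
|sin x|`. The condition on `δ` keeps `x` at least `δ/2` away from `0` and `π`, and Jordan's
inequality bounds the sine. -/
theorem le_orbitDist_wave (hL : 2 < L) {r δ : ℝ} (hr : 0 ≤ r) (hδ : 0 ≤ δ)
    (hδL : δ * L ≤ Real.pi) :
    2 / Real.pi * (r * δ) ≤ orbitDist (wave r : Signal L) (wave (r * Complex.exp (δ * Complex.I))) := by
  refine le_ciInf fun g => ?_
  have hL0 : (0 : ℝ) < L := Nat.cast_pos.2 (NeZero.pos L)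
  have hpi := Real.pi_pos
  set x : ℝ := Real.pi * g.val / L + δ / 2 with hx
  have hv : (g.val : ℝ) + 1 ≤ L := by exact_mod_cast ZMod.val_lt g
  have hx1 : δ / 2 ≤ x := by
    rw [hx]
    have : 0 ≤ Real.pi * g.val / L := by positivity
    linarith
  have hx2 : x ≤ Real.pi - δ / 2 := by
    have : Real.pi * g.val / L ≤ Real.pi - δ := by
      rw [div_le_iff₀ hL0]
      nlinarith
    rw [hx]
    linarith
  have hsin : 2 / Real.pi * (δ / 2) ≤ Real.sin x := by
    rcases le_total x (Real.pi / 2) with h | h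
    · exact le_trans (by gcongr) (Real.mul_le_sin (by linarith) h)
    · rw [← Real.sin_pi_sub]
      exact le_trans (by gcongr; linarith) (Real.mul_le_sin (by linarith) (by linarith))
  have hexp : stdAddChar g * (r * Complex.exp (δ * Complex.I)) =
      r * Complex.exp (Complex.I * (2 * x : ℝ)) := by
    rw [stdAddChar_apply, ZMod.toCircle_apply, mul_left_comm, ← Complex.exp_add, hx]
    congr 2
    push_cast
    ring
  rw [shift_wave, wave_sub, norm_wave hL, hexp, norm_sub_rev, ← mul_sub_one, norm_mul,
    Complex.norm_exp_I_mul_ofReal_sub_one, Complex.norm_real, Real.norm_of_nonneg hr,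
    mul_div_cancel_left₀ _ (two_ne_zero' ℝ)]
  calc 2 / Real.pi * (r * δ) = r * (2 * (2 / Real.pi * (δ / 2))) := by ring
    _ ≤ r * (2 * Real.sin x) := by gcongr
    _ ≤ r * ‖2 * Real.sin x‖ := by gcongr; exact Real.le_norm_self _

/-- Jensen's inequality in the form `e^u ≥ 1 + u`: the orbit sums to zero, so the linear terms
cancel and the bound does not depend on `x`. -/
theorem le_mixtureDensity_wave (hL : 2 < L) (σ : ℝ) (z : ℂ) (x : Signal L) :
    Real.exp (-(‖z‖ ^ 2 / (2 * σ ^ 2))) ≤ mixtureDensity σ (wave z) x := by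
  have hpt : ∀ g : ZMod L, Real.exp (-(‖z‖ ^ 2 / (2 * σ ^ 2))) *
      (1 + σ⁻¹ * inner ℝ (shift g (wave z)) x) ≤ gaussianTilt (σ⁻¹ • shift g (wave z)) x :=
    fun g => by
      have h : inner ℝ (σ⁻¹ • shift g (wave z)) x - ‖σ⁻¹ • shift g (wave z : Signal L)‖ ^ 2 / 2 =
          -(‖z‖ ^ 2 / (2 * σ ^ 2)) + σ⁻¹ * inner ℝ (shift g (wave z)) x := by
        rw [norm_smul, norm_shift, norm_wave hL, real_inner_smul_left, mul_pow, norm_inv, inv_pow,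
          Real.norm_eq_abs, sq_abs]
        ring
      rw [gaussianTilt, h, Real.exp_add]
      gcongr
      linarith [Real.add_one_le_exp (σ⁻¹ * inner ℝ (shift g (wave z)) x)]
  have hL0 : (L : ℝ) ≠ 0 := Nat.cast_ne_zero.2 (NeZero.ne L)
  calc Real.exp (-(‖z‖ ^ 2 / (2 * σ ^ 2)))
      = (L : ℝ)⁻¹ * ∑ g : ZMod L, Real.exp (-(‖z‖ ^ 2 / (2 * σ ^ 2))) *
          (1 + σ⁻¹ * inner ℝ (shift g (wave z)) x) := by
        rw [← Finset.mul_sum, Finset.sum_add_distrib, ← Finset.mul_sum, ← sum_inner,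
          sum_shift_wave (by omega)]
        simp
        field_simp
    _ ≤ _ := by
        rw [mixtureDensity]
        gcongr with g
        exact hpt g

/-! ### Moment matching -/

/-- The `m`-th moment of the uniform distribution on the orbit of `exp (iδ)` under multiplication by
`L`-th roots of unity, projected to the real axis. -/
noncomputable def orbitMoment (L : ℕ) [NeZero L] (m : ℕ) (δ : ℝ) : ℝ :=
  (L : ℝ)⁻¹ * ∑ g : ZMod L, (stdAddChar g * Complex.exp (δ * Complex.I)).re ^ m

/-- Expand the power of `Re z = (z + conj z)/2` binomially; averaging over the roots of unity kills
each frequency `2k - m` not divisible by `L`. -/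
theorem orbitMoment_eq_sum (m : ℕ) (δ : ℝ) :
    orbitMoment L m δ = ∑ k ∈ Finset.range (m + 1), 2⁻¹ ^ m * (m.choose k : ℝ) *
      if (((2 * k - m : ℤ) : ZMod L)) = 0 then Real.cos ((2 * k - m : ℤ) * δ) else 0 := by
  have hpt : ∀ g : ZMod L, (((stdAddChar g * Complex.exp (δ * Complex.I)).re ^ m : ℝ) : ℂ) =
      ∑ k ∈ Finset.range (m + 1), ((2⁻¹ ^ m * (m.choose k : ℝ) : ℝ) : ℂ) *
        (stdAddChar (g * ((2 * k - m : ℤ) : ZMod L)) *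
          Complex.exp (((2 * k - m : ℤ) * δ : ℝ) * Complex.I)) := fun g => by
    have hconj : conj (stdAddChar g * Complex.exp (δ * Complex.I)) =
        stdAddChar (-g) * Complex.exp (-(δ * Complex.I)) := by
      rw [map_mul (starRingEnd ℂ), conj_stdAddChar, ← Complex.exp_conj]
      simp
    rw [Complex.ofReal_pow, Complex.re_eq_add_conj, hconj, div_eq_inv_mul, mul_pow, add_pow,
      Finset.mul_sum]
    refine Finset.sum_congr rfl fun k hk => ?_
    have hk' : k ≤ m := Nat.lt_succ_iff.1 (Finset.mem_range.1 hk)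
    have h1 : stdAddChar (g * ((2 * k - m : ℤ) : ZMod L)) =
        stdAddChar g ^ k * stdAddChar (-g) ^ (m - k) := by
      rw [← AddChar.map_nsmul_eq_pow, ← AddChar.map_nsmul_eq_pow, ← AddChar.map_add_eq_mul]
      congr 1
      rw [nsmul_eq_mul, nsmul_eq_mul, Nat.cast_sub hk']
      push_cast
      ring
    have h2 : Complex.exp (((2 * k - m : ℤ) * δ : ℝ) * Complex.I) =
        Complex.exp (δ * Complex.I) ^ k * Complex.exp (-(δ * Complex.I)) ^ (m - k) := by
      rw [← Complex.exp_nat_mul, ← Complex.exp_nat_mul, ← Complex.exp_add]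
      congr 1
      rw [Nat.cast_sub hk']
      push_cast
      ring
    rw [h1, h2]
    push_cast
    ring
  have hsum : ((∑ g : ZMod L, (stdAddChar g * Complex.exp (δ * Complex.I)).re ^ m : ℝ) : ℂ) =
      ∑ k ∈ Finset.range (m + 1), ((2⁻¹ ^ m * (m.choose k : ℝ) : ℝ) : ℂ) *
        (((if (((2 * k - m : ℤ) : ZMod L)) = 0 then (L : ℝ) else 0 : ℝ) : ℂ) *
          Complex.exp (((2 * k - m : ℤ) * δ : ℝ) * Complex.I)) := by
    rw [Complex.ofReal_sum, Finset.sum_congr rfl fun g _ => hpt g, Finset.sum_comm]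
    refine Finset.sum_congr rfl fun k _ => ?_
    rw [← Finset.mul_sum, ← Finset.sum_mul, sum_stdAddChar_mul, apply_ite Complex.ofReal,
      Complex.ofReal_natCast, Complex.ofReal_zero]
  have hre := congrArg Complex.re hsum
  simp only [Complex.ofReal_re, Complex.re_sum, Complex.re_ofReal_mul,
    Complex.exp_ofReal_mul_I_re] at hre
  rw [orbitMoment, hre, Finset.mul_sum]
  refine Finset.sum_congr rfl fun k _ => ?_
  have hL0 : (L : ℝ) ≠ 0 := Nat.cast_ne_zero.2 (NeZero.ne L)
  split_ifs
  · field_simp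
  · simp

/-- Since `|2k - m| ≤ m < L`, the only surviving frequency is zero. -/
theorem orbitMoment_eq_of_lt {m : ℕ} (hm : m < L) (δ : ℝ) :
    orbitMoment L m δ = orbitMoment L m 0 := by
  rw [orbitMoment_eq_sum, orbitMoment_eq_sum]
  refine Finset.sum_congr rfl fun k hk => ?_
  have hk' : k ≤ m := Nat.lt_succ_iff.1 (Finset.mem_range.1 hk)
  congr 1
  split_ifs with h
  · rw [ZMod.intCast_zmod_eq_zero_iff_dvd] at h
    have : (2 * k - m : ℤ) = 0 := Int.eq_zero_of_abs_lt_dvd h (by rw [abs_lt]; omega)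
    simp [this]
  · rfl

/-- Use `1 - cos x ≤ x²/2` and `|2k - m| ≤ m`; the binomial weights sum to one, so dropping the
divisibility condition costs nothing. -/
theorem orbitMoment_zero_sub_le (m : ℕ) (δ : ℝ) :
    orbitMoment L m 0 - orbitMoment L m δ ≤ (m : ℝ) ^ 2 * δ ^ 2 / 2 := by
  rw [orbitMoment_eq_sum, orbitMoment_eq_sum, ← Finset.sum_sub_distrib]
  calc _ ≤ ∑ k ∈ Finset.range (m + 1), 2⁻¹ ^ m * (m.choose k : ℝ) * ((m : ℝ) ^ 2 * δ ^ 2 / 2) := by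
        refine Finset.sum_le_sum fun k hk => ?_
        have hk' : (k : ℝ) ≤ m := by
          exact_mod_cast Nat.lt_succ_iff.1 (Finset.mem_range.1 hk)
        rw [← mul_sub]
        gcongr
        split_ifs
        · have h1 := Real.one_sub_sq_div_two_le_cos (x := (2 * k - m : ℤ) * δ)
          have h2 : (((2 * k - m : ℤ) : ℝ)) ^ 2 ≤ (m : ℝ) ^ 2 := by
            push_cast
            have : (0 : ℝ) ≤ k := Nat.cast_nonneg k
            exact sq_le_sq' (by linarith) (by linarith)
          have h3 := mul_le_mul_of_nonneg_right h2 (sq_nonneg δ)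
          rw [mul_zero, Real.cos_zero]
          rw [mul_pow] at h1
          linarith
        · simp only [sub_self]
          positivity
    _ = (m : ℝ) ^ 2 * δ ^ 2 / 2 := by
        rw [← Finset.sum_mul, ← Finset.mul_sum]
        have : ∑ k ∈ Finset.range (m + 1), (m.choose k : ℝ) = 2 ^ m := by
          exact_mod_cast Nat.sum_range_choose m
        rw [this, ← mul_pow]
        norm_num

/-- The moment generating function of the orbit distribution of `orbitMoment`. -/
noncomputable def orbitMGF (L : ℕ) [NeZero L] (t δ : ℝ) : ℝ :=
  (L : ℝ)⁻¹ * ∑ g : ZMod L, Real.exp (t * (stdAddChar g * Complex.exp (δ * Complex.I)).re)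

theorem hasSum_orbitMGF (t δ : ℝ) :
    HasSum (fun m : ℕ => t ^ m / m.factorial * orbitMoment L m δ) (orbitMGF L t δ) := by
  have h : HasSum (fun m : ℕ => (L : ℝ)⁻¹ * ∑ g : ZMod L,
      (t * (stdAddChar g * Complex.exp (δ * Complex.I)).re) ^ m / m.factorial)
      (orbitMGF L t δ) := by
    refine HasSum.mul_left _ (hasSum_sum fun g _ => ?_)
    rw [Real.exp_eq_exp_ℝ]
    exact NormedSpace.expSeries_div_hasSum_exp _
  convert h using 2 with m
  rw [orbitMoment, mul_left_comm, Finset.mul_sum]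
  congr 1
  refine Finset.sum_congr rfl fun g _ => ?_
  rw [mul_pow]
  ring

/-- Matching removes all terms below order `L`. The tail is compared with an exponential series
through `t^(j+L) ≤ t^L`, `L! j! ≤ (j+L)!` and `(j+L)² ≤ L² 4^j`, whence `exp 4`. -/
theorem orbitMGF_zero_sub_le {t : ℝ} (ht0 : 0 ≤ t) (ht1 : t ≤ 1) (δ : ℝ) :
    orbitMGF L t 0 - orbitMGF L t δ ≤
      t ^ L / L.factorial * ((L : ℝ) ^ 2 * δ ^ 2 / 2) * Real.exp 4 := by
  have hdiff : HasSum (fun m : ℕ => t ^ m / m.factorial *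
      (orbitMoment L m 0 - orbitMoment L m δ)) (orbitMGF L t 0 - orbitMGF L t δ) := by
    simp_rw [mul_sub]
    exact (hasSum_orbitMGF t 0).sub (hasSum_orbitMGF t δ)
  have hshift : HasSum (fun j : ℕ => t ^ (j + L) / (j + L).factorial *
      (orbitMoment L (j + L) 0 - orbitMoment L (j + L) δ)) (orbitMGF L t 0 - orbitMGF L t δ) := by
    rw [hasSum_nat_add_iff (f := fun m : ℕ => t ^ m / m.factorial *
      (orbitMoment L m 0 - orbitMoment L m δ)) L, Finset.sum_eq_zero, add_zero]
    · exact hdiff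
    · intro m hm
      rw [orbitMoment_eq_of_lt (Finset.mem_range.1 hm) δ, sub_self, mul_zero]
  have hexp : HasSum (fun j : ℕ => t ^ L / L.factorial * ((L : ℝ) ^ 2 * δ ^ 2 / 2) *
      (4 ^ j / j.factorial)) (t ^ L / L.factorial * ((L : ℝ) ^ 2 * δ ^ 2 / 2) * Real.exp 4) := by
    refine HasSum.mul_left _ ?_
    rw [Real.exp_eq_exp_ℝ]
    exact NormedSpace.expSeries_div_hasSum_exp _
  refine hasSum_le (fun j => ?_) hshift hexp
  have hL1 : (1 : ℝ) ≤ L := by exact_mod_cast NeZero.pos L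
  have hj2 : (j : ℝ) + 1 ≤ 2 ^ j := by exact_mod_cast Nat.lt_two_pow_self (n := j)
  have hsq : (((j + L : ℕ) : ℝ)) ^ 2 ≤ (L : ℝ) ^ 2 * 4 ^ j := by
    have h4 : (4 : ℝ) ^ j = (2 ^ j) ^ 2 := by rw [← pow_mul, mul_comm, pow_mul]; norm_num
    rw [h4, ← mul_pow]
    push_cast
    have hj : (0 : ℝ) ≤ j := Nat.cast_nonneg j
    gcongr
    nlinarith
  have hfac : (L.factorial : ℝ) * j.factorial ≤ (j + L).factorial := by
    rw [mul_comm]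
    exact_mod_cast Nat.le_of_dvd (Nat.factorial_pos _) (Nat.factorial_mul_factorial_dvd_factorial_add j L)
  calc _ ≤ t ^ L / (L.factorial * j.factorial) * ((L : ℝ) ^ 2 * 4 ^ j * δ ^ 2 / 2) := by
        refine mul_le_mul_of_nonneg ?_ ((orbitMoment_zero_sub_le _ _).trans ?_) (by positivity)
          (by positivity)
        · gcongr ?_ / ?_
          exact pow_le_pow_of_le_one ht0 ht1 (by omega)
        · gcongr
    _ = _ := by
        field_simp

/-! ### Chi-square bound and reduction to two points -/

/-- Only the phase difference matters, so both self-correlations equal the value at `0`. -/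
theorem mixtureCorrelation_wave (hL : 2 < L) {r : ℝ} (σ α β : ℝ) :
    mixtureCorrelation σ (wave (r * Complex.exp (α * Complex.I)) : Signal L)
      (wave (r * Complex.exp (β * Complex.I))) = orbitMGF L (r ^ 2 / σ ^ 2) (α - β) := by
  rw [mixtureCorrelation, orbitMGF]
  congr 1
  rw [← Equiv.sum_comp (Equiv.neg (ZMod L))]
  refine Finset.sum_congr rfl fun g _ => ?_
  have : (r * Complex.exp (α * Complex.I)) *
      conj (stdAddChar (-g) * (r * Complex.exp (β * Complex.I))) =
      (r ^ 2 : ℝ) * (stdAddChar g * Complex.exp ((α - β : ℝ) * Complex.I)) := by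
    rw [map_mul (starRingEnd ℂ), map_mul (starRingEnd ℂ), conj_stdAddChar, neg_neg,
      ← Complex.exp_conj, Complex.conj_ofReal, map_mul (starRingEnd ℂ), Complex.conj_ofReal,
      Complex.conj_I]
    have : Complex.exp ((α - β : ℝ) * Complex.I) =
        Complex.exp (α * Complex.I) * Complex.exp (β * -Complex.I) := by
      rw [← Complex.exp_add]
      congr 1
      push_cast
      ring
    rw [this]
    push_cast
    ring
  rw [Equiv.neg_apply, shift_wave, inner_wave hL, this, Complex.re_ofReal_mul]
  ring_nf

theorem lintegral_likelihoodRatio {σ : ℝ} (hσ : σ ≠ 0) (θ θ' : Signal L) :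
    ∫⁻ y, likelihoodRatio σ θ θ' y ∂obsLaw σ θ' = 1 := by
  rw [← setLIntegral_univ, ← withDensity_apply _ MeasurableSet.univ, ← obsLaw_eq_withDensity hσ,
    measure_univ]

/-- Independence turns the second moment of the joint likelihood ratio into an `n`-th power. One
factor `1/2` comes from testing, the other from bounding the sum of two risks by twice the supremum.
-/
theorem le_minimaxRisk_of_lintegral_sq_pow_le {σ : ℝ} (hσ : σ ≠ 0) (n : ℕ) {Θ : Set (Signal L)}
    {θ θ' : Signal L} (hθ : θ ∈ Θ) (hθ' : θ' ∈ Θ)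
    (h : (∫⁻ y, likelihoodRatio σ θ θ' y ^ 2 ∂obsLaw σ θ') ^ n ≤ 2) :
    ENNReal.ofReal (orbitDist θ θ' / 4) ≤ minimaxRisk n σ Θ := by
  refine le_iInf fun ⟨T, hT⟩ => ?_
  have h1 : ∫⁻ y, ∏ i, likelihoodRatio σ θ θ' (y i) ∂sampleLaw n σ θ' = 1 := by
    rw [sampleLaw, lintegral_pi_prod (X := fun _ : Fin n => Signal L) (fun _ => obsLaw σ θ')
      (f := fun _ => likelihoodRatio σ θ θ') (by fun_prop)]
    simp [lintegral_likelihoodRatio hσ]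
  have h2 : ∫⁻ y, (∏ i, likelihoodRatio σ θ θ' (y i)) ^ 2 ∂sampleLaw n σ θ' ≤ 2 := by
    simp_rw [← Finset.prod_pow]
    rw [sampleLaw, lintegral_pi_prod (X := fun _ : Fin n => Signal L) (fun _ => obsLaw σ θ')
      (f := fun _ y => likelihoodRatio σ θ θ' y ^ 2) (by fun_prop)]
    simpa using h
  have key := le_lintegral_add_lintegral_of_sq_le (sampleLaw n σ θ')
    (f := fun y => ∏ i, likelihoodRatio σ θ θ' (y i)) (by fun_prop) h1 h2
    (a := fun y => ENNReal.ofReal (orbitDist (T y) θ))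
    (b := fun y => ENNReal.ofReal (orbitDist (T y) θ')) (by fun_prop)
    (ENNReal.ofReal (orbitDist θ θ')) (fun y => by
      rw [← ENNReal.ofReal_add (orbitDist_nonneg _ _) (orbitDist_nonneg _ _)]
      exact ENNReal.ofReal_le_ofReal (orbitDist_triangle _ _ _))
  rw [← sampleLaw_eq_withDensity hσ] at key
  have hsup : ∀ η ∈ Θ, risk n σ T η ≤ ⨆ θ ∈ Θ, risk n σ T θ := fun η hη =>
    le_iSup₂ (f := fun θ _ => risk n σ T θ) η hη
  have hle := key.trans (add_le_add (hsup θ hθ) (hsup θ' hθ'))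
  rw [← two_mul] at hle
  have h4 : ENNReal.ofReal (orbitDist θ θ' / 4) = ENNReal.ofReal (orbitDist θ θ') / 2 / 2 := by
    rw [show orbitDist θ θ' / 4 = orbitDist θ θ' / 2 / 2 by ring,
      ENNReal.ofReal_div_of_pos two_pos, ENNReal.ofReal_div_of_pos two_pos, ENNReal.ofReal_ofNat]
  rw [h4]
  exact ENNReal.div_le_of_le_mul' hle

theorem lintegral_likelihoodRatio_wave_sq_le (hL : 2 < L) {σ r : ℝ} (hr : 0 ≤ r) (hσ : 0 < σ)
    (hrσ : r ≤ σ) (δ : ℝ) :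
    ∫⁻ y, likelihoodRatio σ (wave r : Signal L) (wave (r * Complex.exp (δ * Complex.I))) y ^ 2
        ∂obsLaw σ (wave (r * Complex.exp (δ * Complex.I))) ≤
      ENNReal.ofReal (1 + Real.exp (9 / 2 + r ^ 2) * ((δ * L) ^ 2 / (σ ^ L) ^ 2)) := by
  have ht0 : 0 ≤ r ^ 2 / σ ^ 2 := by positivity
  have ht1 : r ^ 2 / σ ^ 2 ≤ 1 := by
    rw [div_le_one (by positivity)]
    gcongr
  have hnorm : ‖(r * Complex.exp (δ * Complex.I) : ℂ)‖ = r := by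
    rw [norm_mul, Complex.norm_exp_ofReal_mul_I, mul_one, Complex.norm_real, Real.norm_of_nonneg hr]
  have hlow : ∀ x : Signal L,
      Real.exp (-(1 / 2)) ≤ mixtureDensity σ (wave (r * Complex.exp (δ * Complex.I))) x := fun x => by
    refine le_trans ?_ (le_mixtureDensity_wave hL σ _ x)
    rw [hnorm, Real.exp_le_exp, neg_le_neg_iff, mul_comm 2 (σ ^ 2), ← div_div]
    gcongr
  refine (lintegral_likelihoodRatio_sq_le hσ.ne' (Real.exp_pos _) _ _ hlow).trans
    (ENNReal.ofReal_le_ofReal ?_)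
  have h0 : (wave r : Signal L) = wave (r * Complex.exp ((0 : ℝ) * Complex.I)) := by simp
  rw [h0, mixtureCorrelation_wave hL, mixtureCorrelation_wave hL, mixtureCorrelation_wave hL,
    sub_self, sub_self, zero_sub, ← Real.exp_neg, neg_neg]
  have hmgf := orbitMGF_zero_sub_le (L := L) ht0 ht1 (-δ)
  -- The factorial absorbs `r^(2L)`, so the constant does not depend on `L`.
  have hfac := Real.pow_div_factorial_le_exp (r ^ 2) (sq_nonneg r) L
  have hsplit : (r ^ 2 / σ ^ 2) ^ L / L.factorial * ((L : ℝ) ^ 2 * (-δ) ^ 2 / 2) * Real.exp 4 =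
      ((r ^ 2) ^ L / L.factorial) * ((δ * L) ^ 2 / (σ ^ L) ^ 2 * Real.exp 4 / 2) := by
    rw [div_pow, ← pow_mul σ, mul_comm 2 L, pow_mul σ]
    ring
  have hbound : orbitMGF L (r ^ 2 / σ ^ 2) 0 - orbitMGF L (r ^ 2 / σ ^ 2) (-δ) ≤
      Real.exp (r ^ 2) * ((δ * L) ^ 2 / (σ ^ L) ^ 2 * Real.exp 4 / 2) := by
    rw [hsplit] at hmgf
    exact hmgf.trans (by gcongr)
  -- `9/2 = 1/2 + 4`: the density floor and the series tail.
  have hexp : Real.exp (9 / 2 + r ^ 2) = Real.exp (1 / 2) * (Real.exp (r ^ 2) * Real.exp 4) := by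
    rw [← Real.exp_add, ← Real.exp_add]
    ring_nf
  rw [hexp]
  have := mul_le_mul_of_nonneg_left hbound (Real.exp_pos (1 / 2)).le
  linarith

theorem ofReal_one_add_pow_le_two {x : ℝ} {n : ℕ} (hx : 0 ≤ x) (hnx : n * x ≤ 1 / 4) :
    ENNReal.ofReal (1 + x) ^ n ≤ 2 := by
  rw [← ENNReal.ofReal_pow (by positivity), ← ENNReal.ofReal_ofNat]
  refine ENNReal.ofReal_le_ofReal ?_
  calc (1 + x) ^ n ≤ Real.exp x ^ n := by
        gcongr
        linarith [Real.add_one_le_exp x]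
    _ = Real.exp (n * x) := (Real.exp_nat_mul x n).symm
    _ ≤ Real.exp (Real.log 2) := by
        gcongr
        linarith [Real.log_two_gt_d9]
    _ = 2 := Real.exp_log two_pos

end DiscreteMRA

/-! ### Choice of the two signals -/

theorem mainTheorem9 :
    ∀ K : ℝ, ∃ C : ℝ, 0 < C ∧
      ∀ (c c₀ : ℝ), 1 < c → 0 < c₀ → c₀ ≤ K → Real.sqrt 2 * c₀ ≤ c →
      ∀ (L : ℕ) [NeZero L], Odd L →
      ∀ s : ℕ, 1 ≤ s → s ≤ L / 2 →
      ∀ σ : ℝ, (∀ θ ∈ DiscreteMRA.signalClass L c c₀ s, ‖θ‖ ≤ σ) →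
      ∀ n : ℕ, 1 ≤ n →
        ENNReal.ofReal (C / L * min (σ ^ L / Real.sqrt n) 1) ≤
          DiscreteMRA.minimaxRisk n σ (DiscreteMRA.signalClass L c c₀ s) := by
  intro K
  -- Dominates `exp (9/2 + r²)` for the amplitude `r` below, uniformly in `c₀ ≤ K`.
  set A : ℝ := Real.exp (9 / 2 + (1 + 2 * K ^ 2)) with hA
  have hA1 : 1 ≤ A := Real.one_le_exp (by positivity)
  have hpi := Real.pi_pos
  refine ⟨1 / (2 * A) / (2 * Real.pi), by positivity, ?_⟩
  intro c c₀ hc hc₀ hc₀K hcc L _ hodd s hs1 hsL σ hσ n hn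
  have hL : 2 < L := by obtain ⟨k, rfl⟩ := hodd; omega
  have hL0 : (0 : ℝ) < L := Nat.cast_pos.2 (by omega)
  have hn0 : (0 : ℝ) < n := Nat.cast_pos.2 hn
  -- Large enough for the lower norm bound and the Fourier threshold, and at most `c` by hypothesis.
  set r : ℝ := max 1 (√2 * c₀) with hr
  have hr1 : 1 ≤ r := le_max_left _ _
  have hrc : r ≤ c := max_le hc.le hcc
  have hr2 : r ^ 2 ≤ 1 + 2 * K ^ 2 := by
    have hK : c₀ ^ 2 ≤ K ^ 2 := by gcongr
    rcases max_choice 1 (√2 * c₀) with h | h <;> rw [hr, h]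
    · nlinarith [sq_nonneg K]
    · rw [mul_pow, Real.sq_sqrt two_pos.le]
      linarith
  have hmem : ∀ z : ℂ, ‖z‖ = r →
      (DiscreteMRA.wave z : DiscreteMRA.Signal L) ∈ DiscreteMRA.signalClass L c c₀ s :=
    fun z hz => DiscreteMRA.wave_mem_signalClass hL hs1
      (by rw [hz]; exact (inv_le_one_of_one_le₀ hc.le).trans hr1) (by rwa [hz])
      (by rw [hz]; exact le_max_right _ _)
  have hnorm : ∀ δ : ℝ, ‖(r * Complex.exp (δ * Complex.I) : ℂ)‖ = r := fun δ => by
    rw [norm_mul, Complex.norm_exp_ofReal_mul_I, mul_one, Complex.norm_real,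
      Real.norm_of_nonneg (by linarith)]
  have hnorm0 : ‖(r : ℂ)‖ = r := by
    rw [Complex.norm_real, Real.norm_of_nonneg (by linarith)]
  have hrσ : r ≤ σ := by
    simpa only [DiscreteMRA.norm_wave hL, hnorm0] using hσ _ (hmem r hnorm0)
  have hσ0 : 0 < σ := by linarith
  set q : ℝ := min (σ ^ L / √n) 1 with hq
  have hq0 : 0 ≤ q := le_min (by positivity) zero_le_one
  have hq1 : q ≤ 1 := min_le_right _ _
  -- With `δL = q/(2A)`, the bound `q ≤ σ^L/√n` makes `n` times the chi-square bound at most `1/(4A)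
  -- ≤ 1/4`, while `q ≤ 1` ensures `δL ≤ π`.
  set δ : ℝ := 1 / (2 * A) * q / L with hδ
  have hδ0 : 0 ≤ δ := by positivity
  have hδL : δ * L = 1 / (2 * A) * q := div_mul_cancel₀ _ hL0.ne'
  have hA2 : 1 / (2 * A) ≤ 1 := by
    rw [div_le_one (by positivity)]
    linarith
  have hchi : n * (Real.exp (9 / 2 + r ^ 2) * ((δ * L) ^ 2 / (σ ^ L) ^ 2)) ≤ 1 / 4 := by
    have hqn : n * (q ^ 2 / (σ ^ L) ^ 2) ≤ 1 := by
      have h1 : q ^ 2 ≤ (σ ^ L / √n) ^ 2 := by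
        gcongr
        exact min_le_left _ _
      rw [div_pow, Real.sq_sqrt hn0.le, le_div_iff₀ hn0] at h1
      rw [mul_div_assoc', div_le_one (by positivity)]
      linarith
    have hexp : Real.exp (9 / 2 + r ^ 2) ≤ A := by
      rw [hA]
      gcongr
    calc n * (Real.exp (9 / 2 + r ^ 2) * ((δ * L) ^ 2 / (σ ^ L) ^ 2))
        ≤ n * (A * ((δ * L) ^ 2 / (σ ^ L) ^ 2)) := by gcongr
      _ = 1 / (4 * A) * (n * (q ^ 2 / (σ ^ L) ^ 2)) := by
          rw [hδL]
          field_simp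
          ring
      _ ≤ 1 / (4 * 1) * 1 := by gcongr
      _ = 1 / 4 := by norm_num
  refine le_trans (ENNReal.ofReal_le_ofReal ?_)
    (DiscreteMRA.le_minimaxRisk_of_lintegral_sq_pow_le hσ0.ne' n (hmem r hnorm0)
      (hmem (r * Complex.exp (δ * Complex.I)) (hnorm δ)) ?_)
  · have hdist := DiscreteMRA.le_orbitDist_wave (L := L) hL (r := r) (by linarith) hδ0 (by
      rw [hδL]
      nlinarith [Real.pi_gt_three])
    calc 1 / (2 * A) / (2 * Real.pi) / L * q = 2 / Real.pi * (1 * δ) / 4 := by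
          rw [hδ]
          field_simp
          ring
      _ ≤ 2 / Real.pi * (r * δ) / 4 := by gcongr
      _ ≤ _ := by gcongr
  · refine le_trans ?_ (DiscreteMRA.ofReal_one_add_pow_le_two (by positivity) hchi)
    gcongr
    exact DiscreteMRA.lintegral_likelihoodRatio_wave_sq_le hL (by linarith) hσ0 hrσ δ
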